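/- Let $d\in C^1(\mathbb{R})$ with $d(0)=0$, and let $d_0>0$ and $d_1,d_2,p\ge 0$ be constants such that $d'(s)>d_0$ and $|d'(s)|\le d_1+d_2|s|^p$ for all $s\in\mathbb{R}$. Then for all $f,g\in L^2(0,1)$ and all $h=(h_0,h_1)\in\mathbb{R}^2$ there is a unique pair $(P,m)\in H^1(0,1)\times H^1(0,1)$ with $$\partial_x m=f,\qquad \partial_x P+d(m)=g\quad\text{a.e. in }(0,1),\qquad P(0)=h_0,\quad P(1)=h_1,$$ where $\partial_x$ is the weak derivative and the boundary values are those of the continuous representative of $P$. Moreover, there is an absolute constant $c>0$ (independent of $d$, $d_0$, $d_1$, $d_2$, $p$, $f$, $g$, $h$) such that this solution always satisfies, with $|h|_1=|h_0|+|h_1|$, $$\|m\|_{H^1}\le M:=\frac{c}{d_0}\bigl(\|g\|_{L^2}+|h|_1+d_1\|f\|_{L^2}+d_2\|f\|_{L^2}^{p+1}\bigr)+c\|f\|_{L^2},$$ $$\|P\|_{H^1}\le c\bigl(\|g\|_{L^2}+|h|_1+d_1M+d_2M^{p+1}\bigr).$$ -/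

import Mathlib

open MeasureTheory Set
open scoped ContDiff

noncomputable section

/-- The Hilbert space `L²(0,1)` of real square-integrable functions (up to a.e. equality). -/
abbrev L2 : Type := Lp ℝ 2 (volume.restrict (Ioo (0 : ℝ) 1))

/-- Test functions on `(0,1)`: smooth with compact support contained in the open interval. -/
def IsTestFunction (φ : ℝ → ℝ) : Prop :=
  ContDiff ℝ ∞ φ ∧ HasCompactSupport φ ∧ tsupport φ ⊆ Ioo (0 : ℝ) 1

/-- `v ∈ L²(0,1)` is the weak derivative of `u ∈ L²(0,1)`. -/
def HasWeakDeriv (u v : L2) : Prop :=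
  ∀ φ : ℝ → ℝ, IsTestFunction φ →
    ∫ x in Ioo (0 : ℝ) 1, u x * deriv φ x = -∫ x in Ioo (0 : ℝ) 1, v x * φ x

/-- Weak derivatives are unique. -/
theorem HasWeakDeriv.unique {u v w : L2} (hv : HasWeakDeriv u v) (hw : HasWeakDeriv u w) :
    v = w := by
  have hfin : ∀ z : L2, Integrable z (volume.restrict (Ioo (0 : ℝ) 1)) := fun z =>
    (Lp.memLp z).integrable (by norm_num)
  have hz : ∀ᵐ x ∂(volume : Measure ℝ), x ∈ Ioo (0 : ℝ) 1 → v x - w x = 0 := by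
    refine isOpen_Ioo.ae_eq_zero_of_integral_contDiff_smul_eq_zero
      (f := fun x => v x - w x) ?_ ?_
    · exact (IntegrableOn.locallyIntegrableOn ((hfin v).sub (hfin w)))
    · intro φ hφ hc hs
      obtain ⟨C, hC⟩ := hφ.continuous.bounded_above_of_compact_support hc
      have hint : ∀ z : L2, Integrable (fun x => z x * φ x)
          (volume.restrict (Ioo (0 : ℝ) 1)) := fun z =>
        (hfin z).mul_bdd (c := C) hφ.continuous.aestronglyMeasurable (ae_of_all _ hC)
      have h1 : ∫ x in Ioo (0 : ℝ) 1, v x * φ x = ∫ x in Ioo (0 : ℝ) 1, w x * φ x :=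
        neg_injective ((hv φ ⟨hφ, hc, hs⟩).symm.trans (hw φ ⟨hφ, hc, hs⟩))
      have h2 : ∫ x, φ x • (v x - w x) = ∫ x in Ioo (0 : ℝ) 1, φ x • (v x - w x) := by
        refine (setIntegral_eq_integral_of_forall_compl_eq_zero ?_).symm
        intro x hx
        rw [image_eq_zero_of_notMem_tsupport (fun h => hx (hs h)), zero_smul]
      rw [h2]
      have h3 : (fun x => φ x • (v x - w x)) = fun x => v x * φ x - w x * φ x := by
        funext x; simp only [smul_eq_mul]; ring
      rw [h3, integral_sub (hint v) (hint w), h1, sub_self]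
  refine Lp.ext ?_
  filter_upwards [(ae_restrict_iff' measurableSet_Ioo).2 hz] with x hx
  linarith

/-- The Sobolev space `H¹(0,1)`: the `u ∈ L²(0,1)` with a weak derivative in `L²(0,1)`. -/
@[ext]
structure H1 where
  /-- The underlying element of `L²(0,1)`. -/
  toL2 : L2
  exists_wderiv : ∃ v : L2, HasWeakDeriv toL2 v

namespace H1

/-- The weak derivative `∂ₓ u ∈ L²(0,1)` of `u ∈ H¹(0,1)`. -/
def wderiv (u : H1) : L2 := u.exists_wderiv.choose

theorem hasWeakDeriv_wderiv (u : H1) : HasWeakDeriv u.toL2 u.wderiv := u.exists_wderiv.choose_spec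

/-- The norm of `H¹(0,1)`. -/
def h1norm (u : H1) : ℝ := √(‖u.toL2‖ ^ 2 + ‖u.wderiv‖ ^ 2)

/-- `u` takes the values `h 0` at `x = 0` and `h 1` at `x = 1`, where point values are those of
the representative of `u` that is continuous on `[0,1]`. -/
def HasBoundaryValues (u : H1) (h : Fin 2 → ℝ) : Prop :=
  ∃ U : ℝ → ℝ, ContinuousOn U (Icc 0 1) ∧
    (∀ᵐ x ∂(volume.restrict (Ioo (0 : ℝ) 1)), u.toL2 x = U x) ∧ U 0 = h 0 ∧ U 1 = h 1

end H1

/-- The conditions on the damping function `d` with constants `d₀, d₁, d₂, p`. -/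
structure DampingAssumption (d : ℝ → ℝ) (d₀ d₁ d₂ p : ℝ) : Prop where
  d₀_pos : 0 < d₀
  d₁_nonneg : 0 ≤ d₁
  d₂_nonneg : 0 ≤ d₂
  p_nonneg : 0 ≤ p
  contDiff : ContDiff ℝ 1 d
  map_zero : d 0 = 0
  lower : ∀ m : ℝ, d₀ < deriv d m
  upper : ∀ m : ℝ, |deriv d m| ≤ d₁ + d₂ * |m| ^ p

/-- `(p, m)` solves `∂ₓ m = f`, `∂ₓ p + d(m) = g` (a.e.) on `(0,1)`, and `p = h` on `{0,1}`. -/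
structure IsStationarySolution (d : ℝ → ℝ) (f g : L2) (h : Fin 2 → ℝ) (p m : H1) : Prop where
  mass : ∀ᵐ x ∂(volume.restrict (Ioo (0 : ℝ) 1)), m.wderiv x = f x
  momentum : ∀ᵐ x ∂(volume.restrict (Ioo (0 : ℝ) 1)), p.wderiv x + d (m.toL2 x) = g x
  boundary : p.HasBoundaryValues h

/-- The quantity `M` bounding the `H¹` norm of `m`, with `F = ‖f‖`, `G = ‖g‖`, `H = |h|₁`. -/
def boundM (c d₀ d₁ d₂ p F G H : ℝ) : ℝ :=
  c / d₀ * (G + H + d₁ * F + d₂ * F ^ (p + 1)) + c * F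

end

noncomputable section

/-! The problem reduces to one scalar equation. An `H1` function is a constant plus the primitive of
its weak derivative (`hasWeakDeriv_iff`), so `∂ₓ m = f` leaves only the constant `a` in `m = a + ∫₀ˣ
f` unknown. The momentum equation and `P(0) = h 0` then determine `P`, and `P(1) = h 1` becomes
`D(a) = ∫ g - (h 1 - h 0)`, where `D(a) = ∫₀¹ d(a + ∫₀ˣ f) dx` is `meanDamping`.

Since `d' > d₀`, `D` is continuous and grows with slope at least `d₀`. It is therefore a bijection
of `ℝ`, which gives existence and uniqueness. Quantitatively, `d₀ |a| ≤ |D(a)| + |D(0)|`, and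
`|D(0)|` is controlled by the growth of `d` because `|∫₀ˣ f| ≤ ‖f‖`. This yields a pointwise bound
on `m`, hence on `d(m)`, and finally the bounds on `∂ₓ P` and `P`. -/

theorem integral_Ioo_eq_intervalIntegral (F : ℝ → ℝ) :
    ∫ x in Ioo (0 : ℝ) 1, F x = ∫ x in (0 : ℝ)..1, F x := by
  rw [intervalIntegral.integral_of_le zero_le_one, integral_Ioc_eq_integral_Ioo]

theorem ae_Ioo_iff {q : ℝ → Prop} :
    (∀ᵐ x ∂(volume.restrict (Ioo (0 : ℝ) 1)), q x) ↔ ∀ᵐ x, x ∈ Ioo (0 : ℝ) 1 → q x :=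
  ae_restrict_iff' measurableSet_Ioo

theorem intervalIntegral_congr_ae_Ioo {F G : ℝ → ℝ}
    (h : ∀ᵐ x ∂(volume.restrict (Ioo (0 : ℝ) 1)), F x = G x) :
    ∫ x in (0 : ℝ)..1, F x = ∫ x in (0 : ℝ)..1, G x := by
  rw [← integral_Ioo_eq_intervalIntegral, ← integral_Ioo_eq_intervalIntegral]
  exact integral_congr_ae h

/-! ### Test functions and the du Bois-Reymond lemma. -/

namespace IsTestFunction

variable {φ : ℝ → ℝ}

theorem apply_zero (hφ : IsTestFunction φ) : φ 0 = 0 :=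
  image_eq_zero_of_notMem_tsupport fun h => by simpa using hφ.2.2 h

theorem apply_one (hφ : IsTestFunction φ) : φ 1 = 0 :=
  image_eq_zero_of_notMem_tsupport fun h => by simpa using hφ.2.2 h

theorem integral_eq (hφ : IsTestFunction φ) : ∫ x, φ x = ∫ x in (0 : ℝ)..1, φ x :=
  (intervalIntegral.integral_eq_integral_of_support_subset
    ((subset_tsupport φ).trans (hφ.2.2.trans Ioo_subset_Ioc_self))).symm

theorem sub (hφ : IsTestFunction φ) {ψ : ℝ → ℝ} (hψ : IsTestFunction ψ) :
    IsTestFunction (fun x => φ x - ψ x) := by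
  refine ⟨hφ.1.sub hψ.1, hφ.2.1.sub hψ.2.1, ?_⟩
  exact (tsupport_sub φ ψ).trans (union_subset hφ.2.2 hψ.2.2)

theorem const_mul (hφ : IsTestFunction φ) (c : ℝ) : IsTestFunction (fun x => c * φ x) :=
  ⟨contDiff_const.mul hφ.1, hφ.2.1.mul_left, (tsupport_mul_subset_right).trans hφ.2.2⟩

/-- A test function with zero mean is the derivative of a test function. -/
theorem exists_deriv_eq (hφ : IsTestFunction φ) (h0 : ∫ x, φ x = 0) :
    ∃ Φ : ℝ → ℝ, IsTestFunction Φ ∧ deriv Φ = φ := by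
  have hc : Continuous φ := hφ.1.continuous
  have hd : ∀ x, HasDerivAt (fun y => ∫ t in (0 : ℝ)..y, φ t) (φ x) x := fun x =>
    intervalIntegral.integral_hasDerivAt_right (hc.intervalIntegrable _ _)
      hc.stronglyMeasurable.stronglyMeasurableAtFilter hc.continuousAt
  have hderiv : deriv (fun y => ∫ t in (0 : ℝ)..y, φ t) = φ := funext fun x => (hd x).deriv
  rcases (tsupport φ).eq_empty_or_nonempty with he | hne
  · rw [tsupport_eq_empty_iff] at he
    refine ⟨0, ⟨contDiff_const, HasCompactSupport.zero, by simp⟩, ?_⟩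
    rw [he]; simp
  obtain ⟨l, hl⟩ := hφ.2.1.exists_isLeast hne
  obtain ⟨r, hr⟩ := hφ.2.1.exists_isGreatest hne
  have hl0 := (hφ.2.2 hl.1).1
  have hr1 := (hφ.2.2 hr.1).2
  have hzl : ∀ x < l, φ x = 0 := fun x hx =>
    image_eq_zero_of_notMem_tsupport fun h => (hl.2 h).not_gt hx
  have hzr : ∀ x > r, φ x = 0 := fun x hx =>
    image_eq_zero_of_notMem_tsupport fun h => (hr.2 h).not_gt hx
  have hsupp : tsupport (fun y => ∫ t in (0 : ℝ)..y, φ t) ⊆ Icc l r := by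
    refine closure_minimal (fun x hx => ?_) isClosed_Icc
    by_contra hn
    refine hx ?_
    rcases lt_or_ge x l with hxl | hxl
    · refine (intervalIntegral.integral_congr (g := fun _ => (0 : ℝ)) fun t ht => ?_).trans (by simp)
      exact hzl t (ht.2.trans_lt (max_lt hl0 hxl))
    · have hxr : r < x := by
        by_contra h
        exact hn ⟨hxl, not_lt.1 h⟩
      -- To the right of the support, the integral up to `x` is the total mean, which is zero, plus
      -- an integral between `1` and `x`, both of which exceed `r`.
      rw [hφ.integral_eq] at h0
      have := intervalIntegral.integral_add_adjacent_intervals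
        (hc.intervalIntegrable (μ := volume) 0 1) (hc.intervalIntegrable 1 x)
      rw [h0, zero_add] at this
      refine this.symm.trans ((intervalIntegral.integral_congr (g := fun _ => (0 : ℝ))
        fun t ht => ?_).trans (by simp))
      exact hzr t ((lt_min hr1 hxr).trans_le ht.1)
  refine ⟨_, ⟨?_, ?_, ?_⟩, hderiv⟩
  · rw [contDiff_infty_iff_deriv, hderiv]
    exact ⟨fun x => (hd x).differentiableAt, hφ.1⟩
  · exact isCompact_Icc.of_isClosed_subset (isClosed_tsupport _) hsupp
  · exact hsupp.trans fun x hx => ⟨hl0.trans_le hx.1, hx.2.trans_lt hr1⟩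

end IsTestFunction

theorem exists_isTestFunction_integral_eq_one : ∃ ρ, IsTestFunction ρ ∧ ∫ x, ρ x = 1 := by
  let b : ContDiffBump (1 / 2 : ℝ) := ⟨1 / 8, 1 / 4, by norm_num, by norm_num⟩
  refine ⟨b.normed volume, ⟨b.contDiff_normed, b.hasCompactSupport_normed, ?_⟩, b.integral_normed⟩
  rw [b.tsupport_normed_eq, Real.closedBall_eq_Icc]
  intro x hx
  have h1 : (1 / 2 : ℝ) - 1 / 4 ≤ x := hx.1
  have h2 : x ≤ (1 / 2 : ℝ) + 1 / 4 := hx.2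
  constructor <;> linarith

/-- Du Bois-Reymond: an integrable function with vanishing weak derivative is constant. -/
theorem exists_ae_eq_const_of_integral_mul_deriv_eq_zero {w : ℝ → ℝ}
    (hw : IntegrableOn w (Ioo (0 : ℝ) 1))
    (h : ∀ φ, IsTestFunction φ → ∫ x in Ioo (0 : ℝ) 1, w x * deriv φ x = 0) :
    ∃ k : ℝ, ∀ᵐ x ∂(volume.restrict (Ioo (0 : ℝ) 1)), w x = k := by
  obtain ⟨ρ, hρ, hρ1⟩ := exists_isTestFunction_integral_eq_one
  have hint : ∀ {v : ℝ → ℝ} {φ : ℝ → ℝ}, IntegrableOn v (Ioo (0 : ℝ) 1) → IsTestFunction φ →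
      IntegrableOn (fun x => v x * φ x) (Ioo (0 : ℝ) 1) := by
    intro v φ hv hφ
    obtain ⟨C, hC⟩ := hφ.1.continuous.bounded_above_of_compact_support hφ.2.1
    exact hv.mul_bdd (c := C) hφ.1.continuous.aestronglyMeasurable (ae_of_all _ hC)
  have hk : IntegrableOn (fun _ : ℝ => ∫ x in Ioo (0 : ℝ) 1, w x * ρ x) (Ioo (0 : ℝ) 1) :=
    integrableOn_const (by simp)
  -- The constant is forced: testing `w = k` against `ρ`, which has integral one, gives `k = ∫ w ρ`.
  refine ⟨∫ x in Ioo (0 : ℝ) 1, w x * ρ x, ?_⟩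
  set k := ∫ x in Ioo (0 : ℝ) 1, w x * ρ x with hkdef
  have hz : ∀ᵐ x ∂(volume : Measure ℝ), x ∈ Ioo (0 : ℝ) 1 → w x - k = 0 := by
    refine isOpen_Ioo.ae_eq_zero_of_integral_contDiff_smul_eq_zero
      (f := fun x => w x - k) ((hw.sub hk).locallyIntegrableOn) ?_
    intro ψ hψ hc hs
    have hψt : IsTestFunction ψ := ⟨hψ, hc, hs⟩
    have hψi : Integrable ψ := hψ.continuous.integrable_of_hasCompactSupport hc
    have hρi : Integrable ρ := hρ.1.continuous.integrable_of_hasCompactSupport hρ.2.1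
    -- Subtracting `(∫ ψ) ρ` removes the mean of `ψ`, so the difference is the derivative of a test
    -- function; the hypothesis then reads `∫ w ψ = k ∫ ψ`.
    have hη := hψt.sub (hρ.const_mul (∫ x, ψ x))
    obtain ⟨Φ, hΦ, hd⟩ := hη.exists_deriv_eq (by
      rw [integral_sub hψi (hρi.const_mul _), integral_const_mul, hρ1, mul_one, sub_self])
    have h1 := h Φ hΦ
    rw [hd] at h1
    have h2 : ∫ x, ψ x • (w x - k) = ∫ x in Ioo (0 : ℝ) 1, ψ x • (w x - k) := by
      refine (setIntegral_eq_integral_of_forall_compl_eq_zero ?_).symm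
      intro x hx
      rw [image_eq_zero_of_notMem_tsupport (fun h => hx (hs h)), zero_smul]
    have h3 : (fun x => w x * (ψ x - (∫ x, ψ x) * ρ x))
        = fun x => w x * ψ x - (∫ x, ψ x) * (w x * ρ x) := by funext x; ring
    have h4 : (fun x => ψ x • (w x - k)) = fun x => w x * ψ x - k * ψ x := by
      funext x; simp only [smul_eq_mul]; ring
    rw [h3, integral_sub (hint hw hψt) ((hint hw hρ).const_mul _), integral_const_mul] at h1
    rw [h2, h4, integral_sub (hint hw hψt) (hψi.integrableOn.const_mul _), integral_const_mul,
      integral_Ioo_eq_intervalIntegral ψ, ← hψt.integral_eq]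
    linarith
  filter_upwards [ae_Ioo_iff.2 hz] with x hx
  linarith

/-- The primitive vanishing at `0` of the extension by zero of `v`. -/
def primitive (v : L2) (x : ℝ) : ℝ := ∫ t in (0 : ℝ)..x, (Ioo (0 : ℝ) 1).indicator v t

/-! ### Norm bounds in `L²(0,1)`. -/

namespace L2

theorem integrableOn (v : L2) : IntegrableOn v (Ioo (0 : ℝ) 1) :=
  (Lp.memLp v).integrable (by norm_num)

theorem integrable_indicator (v : L2) : Integrable ((Ioo (0 : ℝ) 1).indicator v) :=
  (integrable_indicator_iff measurableSet_Ioo).2 v.integrableOn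

theorem intervalIntegrable_indicator (v : L2) (a b : ℝ) :
    IntervalIntegrable ((Ioo (0 : ℝ) 1).indicator v) volume a b :=
  v.integrable_indicator.intervalIntegrable

theorem indicator_ae_eq (v : L2) :
    ∀ᵐ x ∂(volume.restrict (Ioo (0 : ℝ) 1)), (Ioo (0 : ℝ) 1).indicator v x = v x :=
  ae_Ioo_iff.2 (ae_of_all _ fun _ hx => indicator_of_mem hx _)

/-- The interval has measure one, so `Lᵖ` norms increase with the exponent. -/
theorem integral_abs_le_norm (v : L2) : ∫ x in Ioo (0 : ℝ) 1, |v x| ≤ ‖v‖ := by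
  have : IsProbabilityMeasure (volume.restrict (Ioo (0 : ℝ) 1)) := ⟨by simp⟩
  have h1 : ∫ x in Ioo (0 : ℝ) 1, |v x| =
      (eLpNorm v 1 (volume.restrict (Ioo (0 : ℝ) 1))).toReal := by
    simp_rw [← Real.norm_eq_abs]
    rw [eLpNorm_one_eq_lintegral_enorm, integral_norm_eq_lintegral_enorm (Lp.aestronglyMeasurable v)]
  rw [h1, Lp.norm_def]
  exact ENNReal.toReal_mono (Lp.eLpNorm_ne_top v)
    (eLpNorm_le_eLpNorm_of_exponent_le (by norm_num) (Lp.aestronglyMeasurable v))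

theorem norm_le_of_ae_abs_le {v : L2} {C : ℝ} (hC : 0 ≤ C)
    (h : ∀ᵐ x ∂(volume.restrict (Ioo (0 : ℝ) 1)), |v x| ≤ C) : ‖v‖ ≤ C := by
  simp only [← Real.norm_eq_abs] at h
  simpa [measureUnivNNReal] using Lp.norm_le_of_ae_bound hC h

theorem exists_of_continuous {U : ℝ → ℝ} (hU : Continuous U) :
    ∃ u : L2, ∀ᵐ x ∂(volume.restrict (Ioo (0 : ℝ) 1)), u x = U x := by
  obtain ⟨C, hC⟩ := isCompact_Icc.exists_bound_of_continuousOn (hU.continuousOn (s := Icc (0 : ℝ) 1))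
  have hmem : MemLp U 2 (volume.restrict (Ioo (0 : ℝ) 1)) :=
    MemLp.of_bound hU.aestronglyMeasurable C
      (ae_Ioo_iff.2 (ae_of_all _ fun x hx => hC x (Ioo_subset_Icc_self hx)))
  exact ⟨hmem.toLp, hmem.coeFn_toLp⟩

end L2

/-! ### Primitives, weak derivatives and boundary values. -/

theorem continuous_primitive (v : L2) : Continuous (primitive v) :=
  intervalIntegral.continuous_primitive v.intervalIntegrable_indicator 0

@[simp] theorem primitive_zero (v : L2) : primitive v 0 = 0 := by simp [primitive]

theorem primitive_one (v : L2) : primitive v 1 = ∫ x in Ioo (0 : ℝ) 1, v x := by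
  rw [primitive, ← integral_Ioo_eq_intervalIntegral]
  exact integral_congr_ae v.indicator_ae_eq

theorem abs_primitive_le (v : L2) {x : ℝ} (hx : x ∈ Ioo (0 : ℝ) 1) : |primitive v x| ≤ ‖v‖ := by
  refine (intervalIntegral.abs_integral_le_integral_abs hx.1.le).trans ?_
  refine le_trans ?_ v.integral_abs_le_norm
  have h1 : ∫ x in Ioo (0 : ℝ) 1, |v x| =
      ∫ x in (0 : ℝ)..1, |(Ioo (0 : ℝ) 1).indicator v x| := by
    rw [← integral_Ioo_eq_intervalIntegral]
    refine integral_congr_ae ?_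
    filter_upwards [v.indicator_ae_eq] with y hy
    rw [hy]
  rw [h1]
  exact intervalIntegral.integral_mono_interval le_rfl hx.1.le hx.2.le
    (ae_of_all _ fun _ => abs_nonneg _) (v.intervalIntegrable_indicator 0 1).abs

/-- Integration by parts for absolutely continuous functions: the boundary terms vanish with `φ`,
and the primitive has derivative `v` almost everywhere. -/
theorem integral_primitive_mul_deriv (v : L2) (a : ℝ) {φ : ℝ → ℝ} (hφ : IsTestFunction φ) :
    ∫ x in Ioo (0 : ℝ) 1, (a + primitive v x) * deriv φ x = -∫ x in Ioo (0 : ℝ) 1, v x * φ x := by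
  have hi := v.intervalIntegrable_indicator 0 1
  have hac : AbsolutelyContinuousOnInterval (fun x => a + primitive v x) 0 1 :=
    AbsolutelyContinuousOnInterval.add
      (contDiff_const.contDiffOn.absolutelyContinuousOnInterval)
      (hi.absolutelyContinuousOnInterval_intervalIntegral (c := 0) (by simp))
  have hφac : AbsolutelyContinuousOnInterval φ 0 1 :=
    ((hφ.1.of_le (by exact_mod_cast le_top)).contDiffOn).absolutelyContinuousOnInterval
  rw [integral_Ioo_eq_intervalIntegral, hac.integral_mul_deriv_eq_deriv_mul hφac, hφ.apply_zero,
    hφ.apply_one, integral_Ioo_eq_intervalIntegral, mul_zero, mul_zero, sub_zero, zero_sub]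
  congr 1
  refine intervalIntegral_congr_ae_Ioo (ae_Ioo_iff.2 ?_)
  filter_upwards [hi.ae_hasDerivAt_integral] with x hx hx01
  have hmem : x ∈ uIcc (0 : ℝ) 1 := by
    rw [uIcc_of_le zero_le_one]; exact Ioo_subset_Icc_self hx01
  have := ((hx hmem 0 (by simp)).const_add a).deriv
  rw [indicator_of_mem hx01] at this
  rw [← this]; rfl

/-- `v` is the weak derivative of `u` if and only if `u` is a primitive of `v`. -/
theorem hasWeakDeriv_iff {u v : L2} :
    HasWeakDeriv u v ↔
      ∃ a : ℝ, ∀ᵐ x ∂(volume.restrict (Ioo (0 : ℝ) 1)), u x = a + primitive v x := by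
  constructor
  · intro h
    have hp : IntegrableOn (primitive v) (Ioo (0 : ℝ) 1) :=
      ((continuous_primitive v).integrableOn_Icc).mono_set Ioo_subset_Icc_self
    obtain ⟨k, hk⟩ := exists_ae_eq_const_of_integral_mul_deriv_eq_zero
      (u.integrableOn.sub hp) (by
        intro φ hφ
        have h1 := h φ hφ
        have h2 := integral_primitive_mul_deriv v 0 hφ
        have hdc : Continuous (deriv φ) := hφ.1.continuous_deriv (by exact_mod_cast le_top)
        obtain ⟨C, hC⟩ := hdc.bounded_above_of_compact_support hφ.2.1.deriv
        have hi : ∀ {w : ℝ → ℝ}, IntegrableOn w (Ioo (0 : ℝ) 1) →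
            IntegrableOn (fun x => w x * deriv φ x) (Ioo (0 : ℝ) 1) := fun hw =>
          hw.mul_bdd (c := C) hdc.aestronglyMeasurable (ae_of_all _ hC)
        simp only [zero_add] at h2
        simp only [Pi.sub_apply, sub_mul]
        rw [integral_sub (hi u.integrableOn) (hi hp), h1, h2, sub_self])
    refine ⟨k, ?_⟩
    filter_upwards [hk] with x hx
    rw [Pi.sub_apply] at hx
    linarith
  · rintro ⟨a, ha⟩ φ hφ
    rw [← integral_primitive_mul_deriv v a hφ]
    refine integral_congr_ae ?_
    filter_upwards [ha] with x hx
    rw [hx]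

namespace H1

theorem wderiv_eq {u : H1} {v : L2} (h : HasWeakDeriv u.toL2 v) : u.wderiv = v :=
  u.hasWeakDeriv_wderiv.unique h

theorem exists_eq_primitive (u : H1) :
    ∃ a : ℝ, ∀ᵐ x ∂(volume.restrict (Ioo (0 : ℝ) 1)), u.toL2 x = a + primitive u.wderiv x :=
  hasWeakDeriv_iff.1 u.hasWeakDeriv_wderiv

theorem exists_of_wderiv (a : ℝ) (v : L2) :
    ∃ u : H1, u.wderiv = v ∧
      ∀ᵐ x ∂(volume.restrict (Ioo (0 : ℝ) 1)), u.toL2 x = a + primitive v x := by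
  obtain ⟨u, hu⟩ := L2.exists_of_continuous (continuous_const.add (continuous_primitive v))
  have hw : HasWeakDeriv u v := hasWeakDeriv_iff.2 ⟨a, hu⟩
  exact ⟨⟨u, v, hw⟩, wderiv_eq hw, hu⟩

/-- Continuous functions that agree a.e. on `(0,1)` agree on `[0,1]`, so the continuous
representative can only be `a + primitive u.wderiv`, whose endpoint values are explicit. -/
theorem hasBoundaryValues_iff (u : H1) (h : Fin 2 → ℝ) :
    u.HasBoundaryValues h ↔
      (∀ᵐ x ∂(volume.restrict (Ioo (0 : ℝ) 1)), u.toL2 x = h 0 + primitive u.wderiv x) ∧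
        h 0 + primitive u.wderiv 1 = h 1 := by
  constructor
  · rintro ⟨U, hU, hae, h0, h1⟩
    obtain ⟨a, ha⟩ := u.exists_eq_primitive
    have hV : ContinuousOn (fun x => a + primitive u.wderiv x) (Icc 0 1) :=
      (continuous_const.add (continuous_primitive _)).continuousOn
    have heq : EqOn U (fun x => a + primitive u.wderiv x) (Icc 0 1) := by
      refine Measure.eqOn_Icc_of_ae_eq volume zero_ne_one ?_ hU hV
      rw [restrict_Ioo_eq_restrict_Icc.symm]
      filter_upwards [hae, ha] with x hx hx'
      rw [← hx, hx']
    have e0 : h 0 = a := by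
      rw [← h0, heq (left_mem_Icc.2 zero_le_one)]; simp
    have e1 : h 1 = a + primitive u.wderiv 1 := by
      rw [← h1, heq (right_mem_Icc.2 zero_le_one)]
    rw [e0, e1]
    exact ⟨ha, rfl⟩
  · rintro ⟨hae, h1⟩
    exact ⟨_, (continuous_const.add (continuous_primitive _)).continuousOn, hae, by simp, h1⟩

theorem h1norm_le {u : H1} {A B : ℝ} (hA : ‖u.toL2‖ ≤ A) (hB : ‖u.wderiv‖ ≤ B) :
    u.h1norm ≤ A + B := by
  have h1 := norm_nonneg u.toL2
  have h2 := norm_nonneg u.wderiv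
  refine Real.sqrt_le_iff.2 ⟨by linarith, ?_⟩
  nlinarith

end H1

/-- The mean over `(0,1)` of the damping at the flow `a + ∫₀ˣ f`. -/
def meanDamping (d : ℝ → ℝ) (f : L2) (a : ℝ) : ℝ := ∫ x in (0 : ℝ)..1, d (a + primitive f x)

theorem continuous_damping_comp {d : ℝ → ℝ} (hd : Continuous d) (f : L2) (a : ℝ) :
    Continuous fun x => d (a + primitive f x) :=
  hd.comp (continuous_const.add (continuous_primitive f))

theorem continuous_meanDamping {d : ℝ → ℝ} (hd : Continuous d) (f : L2) :
    Continuous (meanDamping d f) := by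
  refine intervalIntegral.continuous_parametric_intervalIntegral_of_continuous' ?_ 0 1
  exact hd.comp (continuous_fst.add ((continuous_primitive f).comp continuous_snd))

/-! ### Growth and monotonicity of the damping and of its mean. -/

namespace DampingAssumption

variable {d : ℝ → ℝ} {d₀ d₁ d₂ p : ℝ}

theorem continuous (H : DampingAssumption d d₀ d₁ d₂ p) : Continuous d := H.contDiff.continuous

theorem differentiable (H : DampingAssumption d d₀ d₁ d₂ p) : Differentiable ℝ d :=
  H.contDiff.differentiable one_ne_zero

theorem mul_sub_le (H : DampingAssumption d d₀ d₁ d₂ p) {s t : ℝ} (hst : s ≤ t) :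
    d₀ * (t - s) ≤ d t - d s :=
  mul_sub_le_image_sub_of_le_deriv H.differentiable (fun x => (H.lower x).le) hst

/-- Mean value inequality between `0` and `s`, on the symmetric interval `[-|s|, |s|]` so that both
signs of `s` are covered. -/
theorem abs_le (H : DampingAssumption d d₀ d₁ d₂ p) (s : ℝ) :
    |d s| ≤ d₁ * |s| + d₂ * |s| ^ (p + 1) := by
  have hb : ∀ x ∈ Icc (-|s|) |s|, ‖deriv d x‖ ≤ d₁ + d₂ * |s| ^ p := by
    intro x hx
    refine (H.upper x).trans ?_
    have := mul_le_mul_of_nonneg_left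
      (Real.rpow_le_rpow (abs_nonneg x) (_root_.abs_le.2 hx) H.p_nonneg) H.d₂_nonneg
    linarith
  have := (convex_Icc (-|s|) |s|).norm_image_sub_le_of_norm_deriv_le
    (fun x _ => H.differentiable x) hb
    (x := 0) (y := s) ⟨by simp, abs_nonneg s⟩ ⟨neg_abs_le s, le_abs_self s⟩
  rw [H.map_zero, sub_zero, sub_zero, Real.norm_eq_abs, Real.norm_eq_abs] at this
  -- This form of the power law needs only `p + 1 ≠ 0`, so it includes `s = 0`.
  rw [Real.rpow_add_one' (abs_nonneg s) (by linarith [H.p_nonneg])]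
  linarith

theorem abs_le_of_abs_le (H : DampingAssumption d d₀ d₁ d₂ p) {s K : ℝ} (hs : |s| ≤ K) :
    |d s| ≤ d₁ * K + d₂ * K ^ (p + 1) := by
  refine (H.abs_le s).trans (add_le_add (mul_le_mul_of_nonneg_left hs H.d₁_nonneg)
    (mul_le_mul_of_nonneg_left ?_ H.d₂_nonneg))
  exact Real.rpow_le_rpow (abs_nonneg s) hs (by linarith [H.p_nonneg])

theorem mul_sub_le_meanDamping (H : DampingAssumption d d₀ d₁ d₂ p) (f : L2) {a b : ℝ}
    (hab : a ≤ b) : d₀ * (b - a) ≤ meanDamping d f b - meanDamping d f a := by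
  have hi : ∀ a, IntervalIntegrable (fun x => d (a + primitive f x)) volume 0 1 := fun a =>
    (continuous_damping_comp H.continuous f a).intervalIntegrable _ _
  rw [meanDamping, meanDamping, ← intervalIntegral.integral_sub (hi b) (hi a)]
  have := intervalIntegral.integral_mono (μ := volume) zero_le_one
    (_root_.intervalIntegrable_const (c := d₀ * (b - a))) ((hi b).sub (hi a))
    (fun x => by
      have := H.mul_sub_le (add_le_add_left hab (primitive f x))
      simpa using this)
  simpa using this

theorem mul_abs_sub_le_meanDamping (H : DampingAssumption d d₀ d₁ d₂ p) (f : L2) (a b : ℝ) :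
    d₀ * |b - a| ≤ |meanDamping d f b - meanDamping d f a| := by
  rcases le_total a b with h | h
  · rw [abs_of_nonneg (sub_nonneg.2 h)]
    exact (H.mul_sub_le_meanDamping f h).trans (le_abs_self _)
  · rw [abs_sub_comm, abs_of_nonneg (sub_nonneg.2 h), abs_sub_comm]
    exact (H.mul_sub_le_meanDamping f h).trans (le_abs_self _)

theorem meanDamping_injective (H : DampingAssumption d d₀ d₁ d₂ p) (f : L2) :
    Function.Injective (meanDamping d f) := by
  intro a b hab
  have h1 := H.mul_abs_sub_le_meanDamping f b a
  rw [hab, sub_self, abs_zero] at h1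
  have h2 : |a - b| ≤ 0 := nonpos_of_mul_nonpos_right h1 H.d₀_pos
  exact sub_eq_zero.1 (abs_nonpos_iff.1 h2)

theorem meanDamping_surjective (H : DampingAssumption d d₀ d₁ d₂ p) (f : L2) :
    Function.Surjective (meanDamping d f) := by
  intro y
  have h0 := H.d₀_pos
  -- With slope at least `d₀`, moving by `±t` from `0` changes the mean damping by at least `|y -
  -- meanDamping d f 0|`, so the values at `-t` and `t` bracket `y`.
  set t := |y - meanDamping d f 0| / d₀ with ht
  have ht0 : 0 ≤ t := by positivity
  have hdt : d₀ * t = |y - meanDamping d f 0| := by rw [ht]; field_simp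
  have h1 := H.mul_sub_le_meanDamping f ht0
  have h2 := H.mul_sub_le_meanDamping f (neg_nonpos.2 ht0)
  rw [sub_zero] at h1
  rw [zero_sub, neg_neg] at h2
  have h3 := le_abs_self (y - meanDamping d f 0)
  have h4 := neg_abs_le (y - meanDamping d f 0)
  exact mem_range_of_exists_le_of_exists_ge (continuous_meanDamping H.continuous f)
    ⟨-t, by linarith⟩ ⟨t, by linarith⟩

theorem abs_meanDamping_zero_le (H : DampingAssumption d d₀ d₁ d₂ p) (f : L2) :
    |meanDamping d f 0| ≤ d₁ * ‖f‖ + d₂ * ‖f‖ ^ (p + 1) := by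
  have := intervalIntegral.norm_integral_le_of_norm_le_const_ae (a := 0) (b := 1)
    (f := fun x => d (0 + primitive f x)) (C := d₁ * ‖f‖ + d₂ * ‖f‖ ^ (p + 1)) (by
      -- The interval integral runs over `(0,1]`, while the bound on the primitive is stated on the
      -- open interval.
      have h1 : ∀ᵐ x : ℝ, x ≠ 1 := by simp [ae_iff]
      filter_upwards [h1] with x hx hx01
      rw [uIoc_of_le zero_le_one] at hx01
      rw [zero_add]
      exact H.abs_le_of_abs_le (abs_primitive_le f ⟨hx01.1, lt_of_le_of_ne hx01.2 hx⟩))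
  simpa [meanDamping] using this

end DampingAssumption

/-! ### Uniqueness, existence and a priori bounds. -/

namespace IsStationarySolution

variable {d : ℝ → ℝ} {f g : L2} {h : Fin 2 → ℝ} {P m : H1}

theorem mass_wderiv (S : IsStationarySolution d f g h P m) : m.wderiv = f := Lp.ext S.mass

/-- The flow is determined by its inlet value, which is fixed by the total pressure drop. -/
theorem exists_flow_eq (S : IsStationarySolution d f g h P m) :
    ∃ a : ℝ, (∀ᵐ x ∂(volume.restrict (Ioo (0 : ℝ) 1)), m.toL2 x = a + primitive f x) ∧
      meanDamping d f a = primitive g 1 - primitive P.wderiv 1 := by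
  obtain ⟨a, ha⟩ := m.exists_eq_primitive
  rw [S.mass_wderiv] at ha
  refine ⟨a, ha, ?_⟩
  rw [primitive_one, primitive_one, ← integral_sub g.integrableOn P.wderiv.integrableOn,
    integral_Ioo_eq_intervalIntegral]
  refine intervalIntegral_congr_ae_Ioo ?_
  filter_upwards [ha, S.momentum] with x hx hx'
  rw [← hx]
  linarith

theorem pressure_drop (S : IsStationarySolution d f g h P m) :
    primitive P.wderiv 1 = h 1 - h 0 := by
  have := ((P.hasBoundaryValues_iff h).1 S.boundary).2
  linarith

/-- Both inlet constants solve the same scalar equation, so the flows coincide; the momentum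
equation then fixes the pressure derivative and `h 0` fixes the pressure. -/
theorem unique {d₀ d₁ d₂ p : ℝ} (H : DampingAssumption d d₀ d₁ d₂ p) {P' m' : H1}
    (S : IsStationarySolution d f g h P m) (S' : IsStationarySolution d f g h P' m') :
    P = P' ∧ m = m' := by
  obtain ⟨a, ha, hm⟩ := S.exists_flow_eq
  obtain ⟨a', ha', hm'⟩ := S'.exists_flow_eq
  rw [S.pressure_drop] at hm
  rw [S'.pressure_drop, ← hm] at hm'
  have haa : a' = a := H.meanDamping_injective f hm'
  have hmm : m = m' := by
    refine H1.ext (Lp.ext ?_)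
    filter_upwards [ha, ha'] with x hx hx'
    rw [hx, hx', haa]
  refine ⟨?_, hmm⟩
  have hw : P.wderiv = P'.wderiv := by
    refine Lp.ext ?_
    filter_upwards [S.momentum, S'.momentum] with x hx hx'
    rw [← hmm] at hx'
    linarith
  refine H1.ext (Lp.ext ?_)
  filter_upwards [((P.hasBoundaryValues_iff h).1 S.boundary).1,
    ((P'.hasBoundaryValues_iff h).1 S'.boundary).1] with x hx hx'
  rw [hx, hx', hw]

theorem _root_.DampingAssumption.exists_isStationarySolution {d₀ d₁ d₂ p : ℝ}
    (H : DampingAssumption d d₀ d₁ d₂ p) (f g : L2) (h : Fin 2 → ℝ) :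
    ∃ P m : H1, IsStationarySolution d f g h P m := by
  -- This value of the mean damping is exactly what makes `h 0 + ∫ (g - d(m))` equal to `h 1`.
  obtain ⟨a, ha⟩ := H.meanDamping_surjective f (primitive g 1 - (h 1 - h 0))
  obtain ⟨m, hmw, hm⟩ := H1.exists_of_wderiv a f
  obtain ⟨D, hD⟩ := L2.exists_of_continuous (continuous_damping_comp H.continuous f a)
  obtain ⟨P, hPw, hP⟩ := H1.exists_of_wderiv (h 0) (g - D)
  have hw : ∀ᵐ x ∂(volume.restrict (Ioo (0 : ℝ) 1)),
      P.wderiv x = g x - d (a + primitive f x) := by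
    rw [hPw]
    filter_upwards [Lp.coeFn_sub g D, hD] with x hx hx'
    rw [hx, Pi.sub_apply, hx']
  refine ⟨P, m, ae_of_all _ fun x => by rw [hmw], ?_, ?_⟩
  · filter_upwards [hw, hm] with x hx hx'
    rw [hx, hx', sub_add_cancel]
  · rw [H1.hasBoundaryValues_iff, hPw]
    refine ⟨hP, ?_⟩
    have hdrop : meanDamping d f a = primitive g 1 - primitive P.wderiv 1 := by
      rw [primitive_one, primitive_one, ← integral_sub g.integrableOn P.wderiv.integrableOn,
        integral_Ioo_eq_intervalIntegral]
      refine intervalIntegral_congr_ae_Ioo ?_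
      filter_upwards [hw] with x hx
      rw [hx, sub_sub_cancel]
    rw [hPw] at hdrop
    linarith

/-- Comparing the mean damping at `a` and at `0` bounds `a`. A pointwise bound is kept because
`d(m)` has to be estimated pointwise afterwards. -/
theorem abs_flow_le {d₀ d₁ d₂ p : ℝ} (H : DampingAssumption d d₀ d₁ d₂ p)
    (S : IsStationarySolution d f g h P m) :
    ∀ᵐ x ∂(volume.restrict (Ioo (0 : ℝ) 1)), |m.toL2 x| ≤
      1 / d₀ * (‖g‖ + (|h 0| + |h 1|) + d₁ * ‖f‖ + d₂ * ‖f‖ ^ (p + 1)) + ‖f‖ := by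
  obtain ⟨a, ha, hm⟩ := S.exists_flow_eq
  rw [S.pressure_drop] at hm
  have h0 := H.d₀_pos
  have hg : |primitive g 1| ≤ ‖g‖ := by
    rw [primitive_one]
    exact (abs_integral_le_integral_abs).trans g.integral_abs_le_norm
  have hA : d₀ * |a| ≤ ‖g‖ + (|h 0| + |h 1|) + d₁ * ‖f‖ + d₂ * ‖f‖ ^ (p + 1) := by
    have h1 := H.mul_abs_sub_le_meanDamping f 0 a
    rw [sub_zero, hm] at h1
    have h2 := abs_sub (primitive g 1 - (h 1 - h 0)) (meanDamping d f 0)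
    have h3 := abs_sub (primitive g 1) (h 1 - h 0)
    have h4 := abs_sub (h 1) (h 0)
    have h5 := H.abs_meanDamping_zero_le f
    linarith
  have hA' : |a| ≤ 1 / d₀ * (‖g‖ + (|h 0| + |h 1|) + d₁ * ‖f‖ + d₂ * ‖f‖ ^ (p + 1)) := by
    rw [one_div, ← div_eq_inv_mul, le_div_iff₀ h0]
    linarith
  filter_upwards [ha, ae_restrict_mem measurableSet_Ioo] with x hx hx01
  rw [hx]
  exact (abs_add_le _ _).trans (add_le_add hA' (abs_primitive_le f hx01))

/-- The bound on `m` controls `d(m)`, hence `∂ₓ P = g - d(m)`. The factor `2` arises because this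
bound is used once for `∂ₓ P` and once for `P`, as a primitive starting at `h 0`. -/
theorem pressure_h1norm_le {d₀ d₁ d₂ p : ℝ} (H : DampingAssumption d d₀ d₁ d₂ p)
    (S : IsStationarySolution d f g h P m) {M : ℝ}
    (hM : ∀ᵐ x ∂(volume.restrict (Ioo (0 : ℝ) 1)), |m.toL2 x| ≤ M) (hM0 : 0 ≤ M) :
    P.h1norm ≤ 2 * (‖g‖ + (|h 0| + |h 1|) + d₁ * M + d₂ * M ^ (p + 1)) := by
  have h1 := H.d₁_nonneg
  have h2 := H.d₂_nonneg
  have hK : 0 ≤ d₁ * M + d₂ * M ^ (p + 1) := by positivity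
  have hD : ‖g - P.wderiv‖ ≤ d₁ * M + d₂ * M ^ (p + 1) := by
    refine L2.norm_le_of_ae_abs_le hK ?_
    filter_upwards [Lp.coeFn_sub g P.wderiv, S.momentum, hM] with x hx hx' hx''
    rw [hx, Pi.sub_apply, ← hx', add_sub_cancel_left]
    exact H.abs_le_of_abs_le hx''
  have hw : ‖P.wderiv‖ ≤ ‖g‖ + (d₁ * M + d₂ * M ^ (p + 1)) := by
    have := norm_sub_le g (g - P.wderiv)
    rw [sub_sub_cancel] at this
    linarith
  have hP : ‖P.toL2‖ ≤ |h 0| + (‖g‖ + (d₁ * M + d₂ * M ^ (p + 1))) := by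
    refine L2.norm_le_of_ae_abs_le (by positivity) ?_
    filter_upwards [((P.hasBoundaryValues_iff h).1 S.boundary).1,
      ae_restrict_mem measurableSet_Ioo] with x hx hx01
    rw [hx]
    exact (abs_add_le _ _).trans (add_le_add le_rfl ((abs_primitive_le _ hx01).trans hw))
  have := H1.h1norm_le hP hw
  linarith [abs_nonneg (h 0), abs_nonneg (h 1)]

end IsStationarySolution

end

theorem lemma1 :
    ∃ c : ℝ, 0 < c ∧
      ∀ (d : ℝ → ℝ) (d₀ d₁ d₂ p : ℝ), DampingAssumption d d₀ d₁ d₂ p →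
        ∀ (f g : L2) (h : Fin 2 → ℝ),
          (∃! pm : H1 × H1, IsStationarySolution d f g h pm.1 pm.2) ∧
          ∀ P m : H1, IsStationarySolution d f g h P m →
            ∀ M : ℝ, M = boundM c d₀ d₁ d₂ p ‖f‖ ‖g‖ (|h 0| + |h 1|) →
              m.h1norm ≤ M ∧
              P.h1norm ≤ c * (‖g‖ + (|h 0| + |h 1|) + d₁ * M + d₂ * M ^ (p + 1)) := by
  -- The pressure bound requires `2`. For the flow, `‖m‖ ≤ E + ‖f‖` and `‖∂ₓ m‖ = ‖f‖` sum to `E +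
  -- 2‖f‖`, which is at most `M = 2E + 2‖f‖`; here `E` is the `1 / d₀` term of `abs_flow_le`.
  refine ⟨2, two_pos, fun d d₀ d₁ d₂ p H f g h => ⟨?_, fun P m S M hM => ?_⟩⟩
  · obtain ⟨P, m, S⟩ := H.exists_isStationarySolution f g h
    refine ⟨(P, m), S, fun pm S' => ?_⟩
    obtain ⟨h1, h2⟩ := IsStationarySolution.unique H S' S
    exact Prod.ext h1 h2
  · have h0 := H.d₀_pos
    have h1 := H.d₁_nonneg
    have h2 := H.d₂_nonneg
    have hm := S.abs_flow_le H
    set E := 1 / d₀ * (‖g‖ + (|h 0| + |h 1|) + d₁ * ‖f‖ + d₂ * ‖f‖ ^ (p + 1)) with hE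
    have hE0 : 0 ≤ E := by positivity
    have hf := norm_nonneg f
    have hME : M = 2 * E + 2 * ‖f‖ := by
      rw [hM, boundM, hE]; ring
    refine ⟨?_, S.pressure_h1norm_le H (hm.mono fun x hx => hx.trans (by linarith)) (by linarith)⟩
    have hfw : ‖m.wderiv‖ ≤ ‖f‖ := by rw [S.mass_wderiv]
    have := H1.h1norm_le (L2.norm_le_of_ae_abs_le (by positivity) hm) hfw
    linarith
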